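/- For $\tau$ in the upper half-plane $\mathbb{H}$ let $E_2(\tau)=1-24\sum_{n\ge 1}\sigma_1(n)q^n$ with $q=e^{2\pi i\tau}$, where $\sigma_1(n)$ is the sum of the divisors of $n$, and for $N\in\{2,3,5,7\}$ let $$\tilde E_N(\tau)=\frac{1}{N-1}\bigl(N E_2(N\tau)-E_2(\tau)\bigr).$$ Let $F=\{\tau=x+iy\in\mathbb{H}:\ -\tfrac12\le x<\tfrac12,\ x^2+y^2\ge 1\}$ be the fundamental domain of $SL_2(\mathbb{Z})$, and let $$F_N=F\ \cup\ \bigcup_{k=0}^{N-1}\Bigl\{-\frac{1}{\tau+k}:\ \tau\in F\Bigr\}$$ be the fundamental domain of $\Gamma_0(N)$. Put $\rho=e^{2\pi i/3}$. Then the set of zeros of $\tilde E_N$ in $F_N$ is exactly - for $N=2$: $\bigl\{-\frac{1}{i+1}\bigr\}$; - for $N=3$: $\bigl\{-\frac{1}{\rho+2}\bigr\}$; - for $N=5$: $\bigl\{-\frac{1}{i+2},\,-\frac{1}{i+3}\bigr\}$; - for $N=7$: $\bigl\{-\frac{1}{\rho+3},\,-\frac{1}{\rho+5}\bigr\}$.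 Moreover, $\tilde E_N$ does not vanish at any cusp of $\Gamma_0(N)$: for every $\gamma=\begin{pmatrix}a&b\\c&d\end{pmatrix}\in SL_2(\mathbb{Z})$, the function $(c\tau+d)^{-2}\,\tilde E_N\bigl(\frac{a\tau+b}{c\tau+d}\bigr)$ tends to a nonzero limit as $\operatorname{Im}\tau\to\infty$. -/

import Mathlib

open UpperHalfPlane Filter Topology

open scoped MatrixGroups ModularForm ArithmeticFunction.sigma

namespace EisensteinZeros

noncomputable section

/-- The quasimodular Eisenstein series `E₂(τ) = 1 - 24 ∑_{n ≥ 1} σ₁(n) qⁿ` with `q = e^{2πiτ}`,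
for `Im τ > 0` (where the series converges absolutely). -/
def E2 (τ : ℂ) : ℂ :=
  1 - 24 * ∑' n : ℕ+, (σ 1 (n : ℕ) : ℂ) * Complex.exp (2 * Real.pi * Complex.I * τ) ^ (n : ℕ)

/-- On the upper half-plane this is Mathlib's weight two Eisenstein series. -/
theorem E2_coe (τ : ℍ) : E2 (τ : ℂ) = EisensteinSeries.E2 τ :=
  (EisensteinSeries.E2_eq_tsum_cexp τ).symm

/-- `Ẽ_N(τ) = (N E₂(Nτ) - E₂(τ)) / (N - 1)` on the upper half-plane. -/
def Etilde (N : ℕ) (τ : ℍ) : ℂ :=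
  (N * E2 (N * (τ : ℂ)) - E2 (τ : ℂ)) / (N - 1)

/-- The fundamental domain `F_Γ` of `SL₂(ℤ)`: `-1/2 ≤ Re τ < 1/2` and `|τ| ≥ 1`. -/
def fdSL2Z : Set ℍ :=
  {τ | -1 / 2 ≤ τ.re ∧ τ.re < 1 / 2 ∧ 1 ≤ τ.re ^ 2 + τ.im ^ 2}

/-- For a prime `p`, the fundamental domain `F_p = F_Γ ∪ ⋃_{k = 0}^{p - 1} S T^k (F_Γ)`
of `Γ₀(p)`, where `S τ = -1 / τ` and `T τ = τ + 1`. -/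
def fdGamma0 (p : ℕ) : Set ℍ :=
  fdSL2Z ∪ ⋃ k ∈ Finset.range p,
    (fun τ : ℍ ↦ (ModularGroup.S * ModularGroup.T ^ k) • τ) '' fdSL2Z

/-- The zeros of `Ẽ_N` in `F_N`, as complex numbers. -/
def zerosInFd (N : ℕ) : Set ℂ :=
  (fun τ : ℍ ↦ (τ : ℂ)) '' {τ | τ ∈ fdGamma0 N ∧ Etilde N τ = 0}

/-- `ρ = e^{2πi/3}`. -/
def rho : ℂ := Complex.exp (2 * Real.pi * Complex.I / 3)

/-- `f`, of weight `k`, has a well-defined nonzero value at the cusp `c`: for each `γ ∈ SL₂(ℤ)`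
with `γ ∞ = c`, the function `f ∣[k] γ` tends to a nonzero limit at `i∞`. -/
def NonzeroAtCusp (k : ℤ) (f : ℍ → ℂ) (c : OnePoint ℝ) : Prop :=
  ∀ γ : SL(2, ℤ), Matrix.SpecialLinearGroup.mapGL ℝ γ • (OnePoint.infty : OnePoint ℝ) = c →
    ∃ v : ℂ, v ≠ 0 ∧ Tendsto (f ∣[k] γ) atImInfty (𝓝 v)

end

end EisensteinZeros

/-!
The zeros of `Ẽ_N` are read off from the product of its translates under `SL₂(ℤ)`. For `N` prime the
translates are indexed by `ℙ¹(ℤ/N)` (`transl`), and `SL₂(ℤ)` permutes them, so their product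
`translForm N` is a modular form of level one and weight `2 (N + 1)`. Each translate has a nonzero
limit at `i∞` (`exists_tendsto_transl`); this is the nonvanishing at the cusps, and it makes the
product a noncuspidal form.

For `N = 2, 3, 5, 7` the product has weight `6, 8, 12, 16` and turns out to be a nonzero multiple of
`E₆`, `E₄²`, `E₆²`, `E₄⁴`. In each weight it is a multiple of this power plus `Δ g` with `g` of level
one and weight `2 (N + 1) - 12`. For `N = 2, 3` that weight is negative and `g = 0`. For `N = 5`, `g`
is constant, and some translates vanish at `i` by invariance under its stabiliser, so evaluation at
`i` gives `g = 0`. For `N = 7`, `g = a E₄`, and two translates vanish at `ρ`, so the product has a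
double zero there, whereas `E₄` has a simple one; hence `a = 0`.

That `E₆` and `E₄` vanish in the fundamental domain of `SL₂(ℤ)` only at `i` and `ρ` does not need the
valence formula: on the fundamental domain `|q| ≤ 1/200`, and there the power series
`∑ σ_k(n) qⁿ` with `k ≤ 5` is injective since its linear term dominates
(`norm_sub_le_norm_sigmaSeries_sub`). The same estimate shows that the zero of `E₄` at `ρ` is simple.

It remains to see which translates vanish at the elliptic point `τ₀`, equal to `i` or `ρ`. Those
whose index is fixed by the stabiliser of `τ₀` vanish, because the automorphy factor there is not `1`. For
the others, `E₂* = E₂ - 3 / (π Im τ)` vanishes on the whole orbit of `τ₀`, so that a zero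
of `Ẽ_N` at a point `τ` of the orbit would give `E₂(Nτ) = 3 / (π Im (Nτ))`; this is impossible if
`Im (Nτ) ≥ 2`, and every remaining orbit of indices has a representative with that property.
-/

namespace EisensteinZeros

open ModularGroup (S T)
open ModularForm (E₄ E₆)
open scoped Manifold

/-! ### Eisenstein series as functions of `q` -/

/-- The nome `q = e^{2πiτ}`. -/
noncomputable def nome (τ : ℂ) : ℂ := Complex.exp (2 * Real.pi * Complex.I * τ)

lemma norm_nome (τ : ℂ) : ‖nome τ‖ = Real.exp (-(2 * Real.pi * τ.im)) := by
  simp [nome, Complex.norm_exp]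

/-- The bound `17/20` is slightly smaller than `√3/2`, the least imaginary part in the fundamental
domain, so that `ρ` has a neighbourhood on which the estimate holds. -/
lemma norm_nome_le {τ : ℂ} (hτ : 17 / 20 ≤ τ.im) : ‖nome τ‖ ≤ 1 / 200 := by
  rw [norm_nome, Real.exp_neg, one_div]
  gcongr
  have hπ : (5.34 : ℝ) ≤ 2 * Real.pi * τ.im := by nlinarith [Real.pi_gt_d4]
  have h5 : (148 : ℝ) ≤ Real.exp 5 := by
    rw [show (5 : ℝ) = (5 : ℕ) * 1 by norm_num, Real.exp_nat_mul]
    calc (148 : ℝ) ≤ 2.7182818283 ^ 5 := by norm_num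
      _ ≤ Real.exp 1 ^ 5 := by gcongr; exact Real.exp_one_gt_d9.le
  calc (200 : ℝ) ≤ 148 * (0.34 + 1 + 0.34 ^ 2 / 2) := by norm_num
    _ ≤ Real.exp 5 * Real.exp 0.34 := by
      gcongr
      linarith [Real.quadratic_le_exp_of_nonneg (x := 0.34) (by norm_num)]
    _ = Real.exp 5.34 := by rw [← Real.exp_add]; norm_num
    _ ≤ _ := Real.exp_le_exp.mpr hπ

lemma norm_pow_succ_sub_pow_succ_le {x y : ℂ} {r : ℝ} (hx : ‖x‖ ≤ r) (hy : ‖y‖ ≤ r) (n : ℕ) :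
    ‖x ^ (n + 1) - y ^ (n + 1)‖ ≤ (n + 1) * r ^ n * ‖x - y‖ := by
  induction n with
  | zero => simp
  | succ n ih =>
    have hr : 0 ≤ r := (norm_nonneg x).trans hx
    calc ‖x ^ (n + 2) - y ^ (n + 2)‖
        = ‖x * (x ^ (n + 1) - y ^ (n + 1)) + (x - y) * y ^ (n + 1)‖ := by ring_nf
      _ ≤ r * ((n + 1) * r ^ n * ‖x - y‖) + ‖x - y‖ * r ^ (n + 1) := by
        refine (norm_add_le _ _).trans ?_
        rw [norm_mul, norm_mul, norm_pow]
        gcongr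
      _ = _ := by push_cast; ring

/-- Growth bound for the coefficients `n σ_k(n) ≤ n⁷`: the ratio of consecutive seventh powers from
`2⁷` on is at most `(3/2)⁷ < 18`. -/
lemma add_two_pow_seven_le (m : ℕ) : (m + 2) ^ 7 ≤ 128 * 18 ^ m := by
  induction m with
  | zero => norm_num
  | succ m ih =>
    have h : (2 * (m + 3)) ^ 7 ≤ (3 * (m + 2)) ^ 7 := Nat.pow_le_pow_left (by lia) 7
    rw [mul_pow, mul_pow] at h
    rw [show m + 1 + 2 = m + 3 by ring, pow_succ 18]
    lia

/-- The power series `∑_{n ≥ 1} σ_k(n) qⁿ`. -/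
noncomputable def sigmaSeries (k : ℕ) (q : ℂ) : ℂ := ∑' n : ℕ+, (σ k (n : ℕ) : ℂ) * q ^ (n : ℕ)

lemma sigmaSeries_eq (k : ℕ) (q : ℂ) :
    sigmaSeries k q = ∑' m : ℕ, (σ k (m + 1) : ℂ) * q ^ (m + 1) :=
  tsum_pnat_eq_tsum_succ (f := fun n ↦ (σ k n : ℂ) * q ^ n)

lemma norm_sigma_mul_sub_le {k : ℕ} (hk : k ≤ 5) {x y : ℂ} (hx : ‖x‖ ≤ 1 / 200)
    (hy : ‖y‖ ≤ 1 / 200) (m : ℕ) :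
    ‖(σ k (m + 2) : ℂ) * x ^ (m + 2) - (σ k (m + 2) : ℂ) * y ^ (m + 2)‖ ≤
      128 / 200 * ‖x - y‖ * (18 / 200) ^ m := by
  have hσ : ((σ k (m + 2) : ℕ) : ℝ) * (m + 2) ≤ 128 * 18 ^ m := by
    have h := (Nat.mul_le_mul_right (m + 2) (ArithmeticFunction.sigma_le_pow_succ k (m + 2)))
    have h2 : (m + 2) ^ (k + 1) * (m + 2) ≤ (m + 2) ^ 7 := by
      rw [← pow_succ]; exact Nat.pow_le_pow_right (by lia) (by lia)
    exact_mod_cast h.trans (h2.trans (add_two_pow_seven_le m))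
  rw [← mul_sub, norm_mul, Complex.norm_natCast]
  calc (σ k (m + 2) : ℝ) * ‖x ^ (m + 2) - y ^ (m + 2)‖
      ≤ (σ k (m + 2) : ℝ) * (((m + 1 : ℕ) + 1) * (1 / 200) ^ (m + 1) * ‖x - y‖) := by
        gcongr; exact norm_pow_succ_sub_pow_succ_le hx hy (m + 1)
    _ = ((σ k (m + 2) : ℕ) : ℝ) * (m + 2) * ((1 / 200) ^ (m + 1) * ‖x - y‖) := by push_cast; ring
    _ ≤ 128 * 18 ^ m * ((1 / 200) ^ (m + 1) * ‖x - y‖) := by gcongr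
    _ = _ := by rw [div_pow, div_pow, one_pow]; ring

lemma summable_sigma_mul_pow {k : ℕ} (hk : k ≤ 5) {x : ℂ} (hx : ‖x‖ ≤ 1 / 200) :
    Summable fun m : ℕ ↦ (σ k (m + 1) : ℂ) * x ^ (m + 1) := by
  rw [← summable_nat_add_iff 1]
  refine Summable.of_norm_bounded (g := fun m ↦ 128 / 200 * ‖x - 0‖ * (18 / 200) ^ m)
    ((summable_geometric_of_lt_one (by norm_num) (by norm_num)).mul_left _) fun m ↦ ?_
  simpa using norm_sigma_mul_sub_le hk hx (y := 0) (by simp) m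

/-- On the disc `|q| ≤ 1/200` the linear term dominates the variation of `∑ σ_k(n) qⁿ`, so this
series is injective there, quantitatively. -/
lemma norm_sub_le_norm_sigmaSeries_sub {k : ℕ} (hk : k ≤ 5) {x y : ℂ} (hx : ‖x‖ ≤ 1 / 200)
    (hy : ‖y‖ ≤ 1 / 200) : ‖x - y‖ ≤ 4 * ‖sigmaSeries k x - sigmaSeries k y‖ := by
  have hsx := summable_sigma_mul_pow hk hx
  have hsy := summable_sigma_mul_pow hk hy
  have hs := hsx.sub hsy
  have hgeo : HasSum (fun m : ℕ ↦ 128 / 200 * ‖x - y‖ * (18 / 200 : ℝ) ^ m)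
      (128 / 200 * ‖x - y‖ * (1 - 18 / 200)⁻¹) :=
    (hasSum_geometric_of_lt_one (by norm_num) (by norm_num)).mul_left _
  have htail := tsum_of_norm_bounded hgeo (norm_sigma_mul_sub_le hk hx hy)
  have heq : sigmaSeries k x - sigmaSeries k y = (x - y) +
      ∑' m : ℕ, ((σ k (m + 2) : ℂ) * x ^ (m + 2) - (σ k (m + 2) : ℂ) * y ^ (m + 2)) := by
    rw [sigmaSeries_eq, sigmaSeries_eq, ← hsx.tsum_sub hsy, hs.tsum_eq_zero_add]
    simp
  have hxy : ‖x - y‖ ≤ ‖sigmaSeries k x - sigmaSeries k y‖ +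
      128 / 200 * ‖x - y‖ * (1 - 18 / 200)⁻¹ := by
    rw [heq]
    refine le_trans ?_ (add_le_add_right htail _)
    exact (norm_le_add_norm_add _ _)
  norm_num at hxy
  linarith [norm_nonneg (x - y)]

lemma E₄_eq (τ : ℍ) : ModularForm.E₄ τ = 1 + 240 * sigmaSeries 3 (nome τ) := by
  have h := EisensteinSeries.q_expansion_bernoulli (k := 4) (by norm_num) ⟨2, rfl⟩ τ
  rw [show bernoulli 4 = -1 / 30 by decide +kernel] at h
  refine h.trans ?_
  norm_num [sigmaSeries, nome]

lemma E₆_eq (τ : ℍ) : ModularForm.E₆ τ = 1 - 504 * sigmaSeries 5 (nome τ) := by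
  have h := EisensteinSeries.q_expansion_bernoulli (k := 6) (by norm_num) ⟨3, rfl⟩ τ
  rw [show bernoulli 6 = 1 / 42 by decide +kernel] at h
  refine h.trans ?_
  norm_num [sigmaSeries, nome]

/-- Near and on the fundamental domain, `E₄` separates points at least as well as `q` does. -/
lemma norm_nome_sub_le_E₄ {τ τ' : ℍ} (h : 17 / 20 ≤ τ.im) (h' : 17 / 20 ≤ τ'.im) :
    ‖nome τ - nome τ'‖ ≤ ‖ModularForm.E₄ τ - ModularForm.E₄ τ'‖ := by
  have := norm_sub_le_norm_sigmaSeries_sub (k := 3) (by norm_num) (norm_nome_le h) (norm_nome_le h')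
  rw [E₄_eq, E₄_eq, add_sub_add_left_eq_sub, ← mul_sub, norm_mul]
  norm_num
  linarith [norm_nonneg (sigmaSeries 3 (nome τ) - sigmaSeries 3 (nome τ'))]

lemma norm_nome_sub_le_E₆ {τ τ' : ℍ} (h : 17 / 20 ≤ τ.im) (h' : 17 / 20 ≤ τ'.im) :
    ‖nome τ - nome τ'‖ ≤ ‖ModularForm.E₆ τ - ModularForm.E₆ τ'‖ := by
  have := norm_sub_le_norm_sigmaSeries_sub (k := 5) (by norm_num) (norm_nome_le h) (norm_nome_le h')
  rw [E₆_eq, E₆_eq, sub_sub_sub_cancel_left, ← mul_sub, norm_mul, norm_sub_rev (sigmaSeries _ _)]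
  norm_num
  linarith [norm_nonneg (sigmaSeries 5 (nome τ) - sigmaSeries 5 (nome τ'))]

/-- The nome is injective on the strip `-1/2 ≤ Re τ < 1/2`. -/
lemma eq_of_nome_eq {τ τ' : ℍ} (h : τ ∈ fdSL2Z) (h' : τ' ∈ fdSL2Z) (hq : nome τ = nome τ') :
    τ = τ' := by
  obtain ⟨n, hn⟩ := Complex.exp_eq_exp_iff_exists_int.mp hq
  have hτ : (τ : ℂ) = τ' + n := by
    have h2 : (2 * Real.pi * Complex.I : ℂ) ≠ 0 := Complex.two_pi_I_ne_zero
    refine mul_left_cancel₀ h2 ?_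
    linear_combination hn
  have hre : τ.re = τ'.re + n := by simpa using congrArg Complex.re hτ
  have h1 : (n : ℝ) < 1 := by linarith [h.2.1, h'.1]
  have h2 : (-1 : ℝ) < n := by linarith [h.1, h'.2.1]
  have hn0 : n = 0 := by
    have : n < 1 := by exact_mod_cast h1
    have : -1 < n := by exact_mod_cast h2
    lia
  ext
  simpa [hn0] using hτ

lemma im_ge_of_mem_fdSL2Z {τ : ℍ} (h : τ ∈ fdSL2Z) : 17 / 20 ≤ τ.im := by
  obtain ⟨h1, h2, h3⟩ := h
  nlinarith [τ.im_pos]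

/-- `E₄` is injective on the fundamental domain, because it is injective as a function of `q` on a
disc that contains all the values of the nome there. -/
lemma eq_of_E₄_eq {τ τ' : ℍ} (h : τ ∈ fdSL2Z) (h' : τ' ∈ fdSL2Z)
    (he : ModularForm.E₄ τ = ModularForm.E₄ τ') : τ = τ' := by
  have := norm_nome_sub_le_E₄ (im_ge_of_mem_fdSL2Z h) (im_ge_of_mem_fdSL2Z h')
  rw [he, sub_self, norm_zero, norm_le_zero_iff, sub_eq_zero] at this
  exact eq_of_nome_eq h h' this

lemma eq_of_E₆_eq {τ τ' : ℍ} (h : τ ∈ fdSL2Z) (h' : τ' ∈ fdSL2Z)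
    (he : ModularForm.E₆ τ = ModularForm.E₆ τ') : τ = τ' := by
  have := norm_nome_sub_le_E₆ (im_ge_of_mem_fdSL2Z h) (im_ge_of_mem_fdSL2Z h')
  rw [he, sub_self, norm_zero, norm_le_zero_iff, sub_eq_zero] at this
  exact eq_of_nome_eq h h' this

/-- An explicit form of `E₂ = 1 + O(q)`, from `σ₁(n) ≤ n² ≤ 4ⁿ`. -/
lemma norm_E2_sub_one_le {τ : ℂ} (h : ‖nome τ‖ ≤ 1 / 8) : ‖E2 τ - 1‖ ≤ 192 * ‖nome τ‖ := by
  set r := ‖nome τ‖ with hr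
  have hgeo : HasSum (fun m : ℕ ↦ 4 * r * (4 * r) ^ m) (4 * r * (1 - 4 * r)⁻¹) :=
    (hasSum_geometric_of_lt_one (by positivity) (by linarith)).mul_left _
  have hb : ‖sigmaSeries 1 (nome τ)‖ ≤ 4 * r * (1 - 4 * r)⁻¹ := by
    rw [sigmaSeries_eq]
    refine tsum_of_norm_bounded hgeo fun m ↦ ?_
    have hσ : ((σ 1 (m + 1) : ℕ) : ℝ) ≤ 4 ^ (m + 1) := by
      have h1 := ArithmeticFunction.sigma_le_pow_succ 1 (m + 1)
      have h2 : (m + 1) ^ (1 + 1) ≤ (2 ^ (m + 1)) ^ 2 :=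
        Nat.pow_le_pow_left Nat.lt_two_pow_self.le 2
      rw [← pow_mul, mul_comm, pow_mul] at h2
      exact_mod_cast h1.trans h2
    rw [norm_mul, norm_pow, Complex.norm_natCast, ← hr]
    calc _ ≤ 4 ^ (m + 1) * r ^ (m + 1) := by gcongr
      _ = _ := by ring
  have he : E2 τ - 1 = -24 * sigmaSeries 1 (nome τ) := by
    simp only [E2, sigmaSeries, nome]; ring
  have hinv : (1 - 4 * r)⁻¹ ≤ 2 := by
    rw [inv_le_comm₀ (by linarith) (by norm_num)]; linarith
  rw [he, norm_mul]
  calc _ ≤ 24 * (4 * r * 2) := by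
        norm_num
        refine hb.trans ?_
        gcongr
    _ = _ := by ring

/-- High up in the half-plane, `E₂` is too close to `1` to take the value `3 / (π Im τ)`. -/
lemma E2_ne_of_two_le_im {τ : ℂ} (h : 2 ≤ τ.im) : E2 τ ≠ (3 / (Real.pi * τ.im) : ℝ) := by
  have hπ := Real.pi_gt_three
  have hq : ‖nome τ‖ ≤ 1 / 4096 := by
    rw [norm_nome, Real.exp_neg, one_div]
    gcongr
    calc (4096 : ℝ) = 2 ^ 12 := by norm_num
      _ ≤ Real.exp 1 ^ 12 := by gcongr; linarith [Real.exp_one_gt_d9]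
      _ = Real.exp 12 := by rw [← Real.exp_nat_mul]; norm_num
      _ ≤ _ := Real.exp_le_exp.mpr (by nlinarith)
  have hE := norm_E2_sub_one_le (hq.trans (by norm_num))
  have hle : 3 / (Real.pi * τ.im) ≤ 1 / 2 := by
    rw [div_le_div_iff₀ (by positivity) (by norm_num)]
    nlinarith
  intro heq
  rw [heq, ← Complex.ofReal_one, ← Complex.ofReal_sub, Complex.norm_real, Real.norm_eq_abs,
    abs_sub_comm] at hE
  have := le_abs_self (1 - 3 / (Real.pi * τ.im))
  linarith

lemma tendsto_nome_atImInfty : Tendsto (fun τ : ℍ ↦ nome τ) atImInfty (𝓝 0) := by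
  simpa [nome, Function.Periodic.qParam] using qParam_tendsto_atImInfty one_pos

lemma tendsto_E2 {α : Type*} {l : Filter α} {u : α → ℂ}
    (hu : Tendsto (fun a ↦ nome (u a)) l (𝓝 0)) :
    Tendsto (fun a ↦ E2 (u a)) l (𝓝 1) := by
  rw [tendsto_iff_norm_sub_tendsto_zero]
  have hn := tendsto_norm_zero.comp hu
  refine squeeze_zero' (Eventually.of_forall fun _ ↦ norm_nonneg _) ?_
    (by simpa using hn.const_mul 192)
  filter_upwards [hn.eventually_le_const (show (0 : ℝ) < 1 / 8 by norm_num)] with a ha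
  exact norm_E2_sub_one_le ha

/-! ### Transformation behaviour -/

/-- The transformation law of `E₂`, with its quasimodular correction term. -/
lemma E2_smul (γ : SL(2, ℤ)) (τ : ℍ) :
    E2 (γ • τ : ℍ) = denom γ τ ^ 2 * E2 τ - 6 * Complex.I * γ 1 0 / Real.pi * denom γ τ := by
  have h := congrFun (EisensteinSeries.E2_slash_action γ) τ
  have hd : denom γ τ ≠ 0 := denom_ne_zero _ _
  have hπ : (Real.pi : ℂ) ≠ 0 := by exact_mod_cast Real.pi_ne_zero
  rw [ModularForm.SL_slash_apply, Pi.sub_apply, Pi.smul_apply, ← E2_coe, ← E2_coe,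
    EisensteinSeries.D2, riemannZeta_two, zpow_neg, zpow_ofNat, ← div_eq_mul_inv,
    div_eq_iff (pow_ne_zero 2 hd)] at h
  rw [h, smul_eq_mul]
  field_simp

/-- The completed series `E₂*(τ) = E₂(τ) - 3 / (π Im τ)`, modular of weight two but not
holomorphic. -/
noncomputable def E2star (τ : ℍ) : ℂ := E2 τ - 3 / (Real.pi * τ.im)

lemma E2star_slash (γ : SL(2, ℤ)) : E2star ∣[(2 : ℤ)] γ = E2star := by
  ext τ
  have hd : denom γ τ ≠ 0 := denom_ne_zero _ _
  have hπ : (Real.pi : ℂ) ≠ 0 := by exact_mod_cast Real.pi_ne_zero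
  have hy : (τ.im : ℂ) ≠ 0 := by exact_mod_cast τ.im_pos.ne'
  have him : (((γ • τ : ℍ).im : ℝ) : ℂ) = τ.im / (denom γ τ * (starRingEnd ℂ) (denom γ τ)) := by
    rw [ModularGroup.im_smul_eq_div_normSq, Complex.ofReal_div, Complex.mul_conj]
  have hc : (starRingEnd ℂ) (denom γ τ) = denom γ τ - 2 * Complex.I * γ 1 0 * τ.im := by
    rw [ModularGroup.denom_apply]
    apply Complex.ext <;> simp
    ring
  have hc0 : (starRingEnd ℂ) (denom γ τ) ≠ 0 := by simp
  rw [ModularForm.SL_slash_apply, zpow_neg, zpow_ofNat, ← div_eq_mul_inv,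
    div_eq_iff (pow_ne_zero 2 hd), E2star, E2star, E2_smul, him]
  field_simp
  rw [hc]
  ring

/-- A form invariant under `γ` vanishes at a fixed point of `γ` at which the automorphy factor
is not `1`. -/
lemma eq_zero_of_slash_eq_of_smul_eq {f : ℍ → ℂ} {k : ℤ} {γ : SL(2, ℤ)} {τ : ℍ}
    (hf : f ∣[k] γ = f) (hτ : γ • τ = τ) (hd : denom γ τ ^ (-k) ≠ 1) : f τ = 0 := by
  have h := congrFun hf τ
  rw [ModularForm.SL_slash_apply, hτ] at h
  by_contra h0
  exact hd (mul_left_cancel₀ h0 (h.trans (mul_one _).symm))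

/-- If `f ∣[k] γ = g` and `γ` fixes `τ`, then `g τ` vanishes exactly when `f τ` does. -/
lemma eq_zero_iff_of_slash_eq {f g : ℍ → ℂ} {k : ℤ} {γ : SL(2, ℤ)} {τ : ℍ}
    (hf : f ∣[k] γ = g) (hτ : γ • τ = τ) : g τ = 0 ↔ f τ = 0 := by
  rw [← hf, ModularForm.SL_slash_apply, hτ, mul_eq_zero,
    or_iff_left (zpow_ne_zero _ (denom_ne_zero _ _))]

/-- The point `Nτ`. -/
noncomputable def natScale (N : ℕ) [NeZero N] (τ : ℍ) : ℍ :=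
  ⟨N * τ, by simpa using mul_pos (Nat.cast_pos.mpr (NeZero.pos N)) τ.im_pos⟩

lemma coe_natScale (N : ℕ) [NeZero N] (τ : ℍ) : (natScale N τ : ℂ) = N * τ := rfl

/-- The quasimodular corrections of `N E₂(Nτ)` and `E₂(τ)` under `Γ₀(N)` cancel: `γ` acts on `Nτ` as
`!![a, N * b; c / N, d]`, with the same automorphy factor. -/
lemma Etilde_slash_of_mem_Gamma0 {N : ℕ} [NeZero N] {γ : SL(2, ℤ)}
    (hγ : γ ∈ CongruenceSubgroup.Gamma0 N) : Etilde N ∣[(2 : ℤ)] γ = Etilde N := by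
  rw [CongruenceSubgroup.Gamma0_mem, ZMod.intCast_zmod_eq_zero_iff_dvd] at hγ
  obtain ⟨c, hc⟩ := hγ
  have hdet : γ 0 0 * γ 1 1 - N * γ 0 1 * c = 1 := by
    have := γ.det_coe
    rw [Matrix.det_fin_two, hc] at this
    linarith
  let γ' : SL(2, ℤ) := ⟨!![γ 0 0, N * γ 0 1; c, γ 1 1], by rw [Matrix.det_fin_two_of, hdet]⟩
  ext τ
  have hd : denom γ τ ≠ 0 := denom_ne_zero _ _
  have hd' : denom γ' (natScale N τ) = denom γ τ := by
    rw [ModularGroup.denom_apply, ModularGroup.denom_apply, hc, coe_natScale]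
    simp [γ']
    ring
  have hsmul : (N : ℂ) * (γ • τ : ℍ) = (γ' • natScale N τ : ℍ) := by
    have e1 := coe_specialLinearGroup_apply γ τ
    have e2 := coe_specialLinearGroup_apply γ' (natScale N τ)
    rw [coe_natScale] at e2
    rw [e1, e2]
    simp only [hc, γ']
    simp
    rw [mul_div_assoc']
    congr 1 <;> ring
  rw [ModularForm.SL_slash_apply, zpow_neg, zpow_ofNat, ← div_eq_mul_inv,
    div_eq_iff (pow_ne_zero 2 hd), Etilde, Etilde, hsmul, E2_smul, E2_smul, hd', hc, coe_natScale]
  simp [γ']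
  ring

/-- `Ẽ_N ∣ γ` depends only on the class of the bottom row of `γ` in `ℙ¹(ℤ/N)`. -/
lemma Etilde_slash_eq_of_row {N : ℕ} [NeZero N] {γ γ' : SL(2, ℤ)}
    (h : (γ 1 0 * γ' 1 1 : ZMod N) = γ 1 1 * γ' 1 0) :
    Etilde N ∣[(2 : ℤ)] γ = Etilde N ∣[(2 : ℤ)] γ' := by
  have hmem : γ * γ'⁻¹ ∈ CongruenceSubgroup.Gamma0 N := by
    rw [CongruenceSubgroup.Gamma0_mem]
    have : (γ * γ'⁻¹) 1 0 = γ 1 0 * γ' 1 1 - γ 1 1 * γ' 1 0 := by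
      simp [Matrix.SpecialLinearGroup.coe_inv, Matrix.adjugate_fin_two, Matrix.mul_apply,
        Fin.sum_univ_two]
      ring
    rw [this]
    push_cast
    rw [h, sub_self]
  have := Etilde_slash_of_mem_Gamma0 hmem
  rw [← inv_mul_cancel_right γ γ', SlashAction.slash_mul]
  rw [this]

lemma coe_S_mul_T_pow (k : ℕ) : ((S * T ^ k : SL(2, ℤ)) : Matrix (Fin 2) (Fin 2) ℤ) =
    !![0, -1; 1, (k : ℤ)] := by
  have := ModularGroup.coe_T_zpow k
  rw [zpow_natCast] at this
  rw [Matrix.SpecialLinearGroup.coe_mul, this, ModularGroup.S]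
  simp

lemma denom_S_mul_T_pow (k : ℕ) (τ : ℍ) :
    denom ((S * T ^ k : SL(2, ℤ)) : SL(2, ℤ)) τ = τ + k := by
  rw [ModularGroup.denom_apply, coe_S_mul_T_pow]
  simp

lemma coe_S_mul_T_pow_smul (k : ℕ) (τ : ℍ) :
    (((S * T ^ k : SL(2, ℤ)) • τ : ℍ) : ℂ) = -1 / (τ + k) := by
  rw [coe_specialLinearGroup_apply, coe_S_mul_T_pow]
  simp

/-- The expansion of `Ẽ_N` at the cusp `0`; the point `u` is `τ / N`. -/
lemma Etilde_slash_S (N : ℕ) [NeZero N] (τ u : ℍ) (hu : (τ : ℂ) = N * u) :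
    (Etilde N ∣[(2 : ℤ)] S) τ = (E2 u / N - E2 τ) / (N - 1) := by
  have hN : (N : ℂ) ≠ 0 := by exact_mod_cast NeZero.ne N
  have hu0 : (u : ℂ) ≠ 0 := ne_zero u
  have hτ0 : (τ : ℂ) ≠ 0 := ne_zero τ
  have hπ : (Real.pi : ℂ) ≠ 0 := by exact_mod_cast Real.pi_ne_zero
  have hS : (N : ℂ) * (S • τ : ℍ) = (S • u : ℍ) := by
    rw [modular_S_smul, modular_S_smul]
    simp only [hu]
    field_simp
  rw [ModularForm.SL_slash_apply, zpow_neg, zpow_ofNat, ← div_eq_mul_inv, Etilde, hS, E2_smul,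
    E2_smul, ModularGroup.denom_S, ModularGroup.denom_S]
  simp only [ModularGroup.S]
  simp
  rw [div_right_comm]
  congr 1
  field_simp
  rw [hu]
  ring

/-! ### The translates of `Ẽ_N` and their product -/

/-- The translates of `Ẽ_N` under `SL₂(ℤ)`, indexed by `ℙ¹(ℤ/N)`: `none` is the point at infinity,
with translate `Ẽ_N`, and `some k` is `k`, with translate `Ẽ_N ∣ S T^k`. -/
noncomputable def transl (N : ℕ) : Option (ZMod N) → ℍ → ℂ
  | none => Etilde N
  | some k => Etilde N ∣[(2 : ℤ)] (S * T ^ k.val)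

lemma Etilde_slash_eq_transl_none {N : ℕ} [NeZero N] {γ : SL(2, ℤ)} (h : (γ 1 0 : ZMod N) = 0) :
    Etilde N ∣[(2 : ℤ)] γ = transl N none :=
  Etilde_slash_of_mem_Gamma0 (CongruenceSubgroup.Gamma0_mem.mpr h)

lemma Etilde_slash_eq_transl_some {N : ℕ} [NeZero N] {γ : SL(2, ℤ)} {k : ZMod N}
    (h : γ 1 0 * k = γ 1 1) : Etilde N ∣[(2 : ℤ)] γ = transl N (some k) := by
  refine Etilde_slash_eq_of_row ?_
  rw [coe_S_mul_T_pow]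
  simpa using h

lemma exists_Etilde_slash_eq_transl (N : ℕ) [Fact N.Prime] (γ : SL(2, ℤ)) :
    ∃ i, Etilde N ∣[(2 : ℤ)] γ = transl N i := by
  by_cases h : (γ 1 0 : ZMod N) = 0
  · exact ⟨none, Etilde_slash_eq_transl_none h⟩
  · exact ⟨some ((γ 1 0 : ZMod N)⁻¹ * γ 1 1), Etilde_slash_eq_transl_some
      (mul_inv_cancel_left₀ h _)⟩

lemma transl_some_slash (N : ℕ) (k : ZMod N) (γ : SL(2, ℤ)) :
    transl N (some k) ∣[(2 : ℤ)] γ = Etilde N ∣[(2 : ℤ)] (S * T ^ k.val * γ) :=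
  (SlashAction.slash_mul _ _ _ _).symm

lemma S_mul_T_pow_mul_one_zero (k : ℕ) (γ : SL(2, ℤ)) :
    (S * T ^ k * γ) 1 0 = γ 0 0 + k * γ 1 0 := by
  rw [Matrix.SpecialLinearGroup.coe_mul, coe_S_mul_T_pow]
  simp [Matrix.mul_apply, Fin.sum_univ_two]

lemma S_mul_T_pow_mul_one_one (k : ℕ) (γ : SL(2, ℤ)) :
    (S * T ^ k * γ) 1 1 = γ 0 1 + k * γ 1 1 := by
  rw [Matrix.SpecialLinearGroup.coe_mul, coe_S_mul_T_pow]
  simp [Matrix.mul_apply, Fin.sum_univ_two]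

lemma transl_some_slash_eq_none {N : ℕ} [NeZero N] {k : ZMod N} {γ : SL(2, ℤ)}
    (h : (γ 0 0 + k * γ 1 0 : ZMod N) = 0) : transl N (some k) ∣[(2 : ℤ)] γ = transl N none := by
  rw [transl_some_slash]
  refine Etilde_slash_eq_transl_none ?_
  rw [S_mul_T_pow_mul_one_zero]
  simpa using h

lemma transl_some_slash_eq_some {N : ℕ} [NeZero N] {k l : ZMod N} {γ : SL(2, ℤ)}
    (h : (γ 0 0 + k * γ 1 0 : ZMod N) * l = γ 0 1 + k * γ 1 1) :
    transl N (some k) ∣[(2 : ℤ)] γ = transl N (some l) := by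
  rw [transl_some_slash]
  refine Etilde_slash_eq_transl_some ?_
  rw [S_mul_T_pow_mul_one_zero, S_mul_T_pow_mul_one_one]
  simpa using h

/-- The permutation `k ↦ -1/k` of `ℙ¹(ℤ/N)`. -/
def invNeg (N : ℕ) [Fact N.Prime] : Option (ZMod N) → Option (ZMod N)
  | none => some 0
  | some k => if k = 0 then none else some (-k⁻¹)

lemma invNeg_involutive (N : ℕ) [Fact N.Prime] : Function.Involutive (invNeg N) := by
  rintro (_ | k)
  · simp [invNeg]
  · by_cases h : k = 0 <;> simp [invNeg, h, inv_neg]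

lemma transl_slash_S (N : ℕ) [Fact N.Prime] (i : Option (ZMod N)) :
    transl N i ∣[(2 : ℤ)] S = transl N (invNeg N i) := by
  rcases i with _ | k
  · exact Etilde_slash_eq_transl_some (by simp [S])
  · by_cases h : k = 0
    · simp only [invNeg, h, if_true]
      exact transl_some_slash_eq_none (by simp [S])
    · simp only [invNeg, h, if_false]
      exact transl_some_slash_eq_some (by simp [S, h])

lemma transl_slash_T (N : ℕ) [Fact N.Prime] (i : Option (ZMod N)) :
    transl N i ∣[(2 : ℤ)] T = transl N (i.map (· + 1)) := by
  rcases i with _ | k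
  · exact Etilde_slash_eq_transl_none (by simp [T])
  · exact transl_some_slash_eq_some (by simp [T, add_comm])

/-- The product of all translates of `Ẽ_N`, as a function. -/
noncomputable def translProd (N : ℕ) [Fact N.Prime] : ℍ → ℂ := ∏ i, transl N i

lemma translProd_slash (N : ℕ) [Fact N.Prime] (γ : SL(2, ℤ)) :
    translProd N ∣[(2 * (N + 1) : ℤ)] γ = translProd N := by
  have key (γ : SL(2, ℤ)) (e : Equiv.Perm (Option (ZMod N)))
      (h : ∀ i, transl N i ∣[(2 : ℤ)] γ = transl N (e i)) :
      translProd N ∣[(2 * (N + 1) : ℤ)] γ = translProd N := by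
    have hcard : (2 * (N + 1) : ℤ) = 2 * (Finset.univ : Finset (Option (ZMod N))).card := by
      simp [ZMod.card]
    rw [hcard, translProd, ModularForm.SL_slash, ModularForm.prod_slash]
    simp only [← ModularForm.SL_slash, h]
    simpa using Equiv.prod_comp e (transl N)
  refine SlashInvariantForm.slash_action_generators_SL2Z ?_ ?_ γ
  · exact key S (invNeg_involutive N).toPerm (transl_slash_S N)
  · exact key T (Equiv.optionCongr (Equiv.addRight 1)) fun i ↦ by
      rw [transl_slash_T]; rfl

/-! ### Behaviour at the cusps -/

lemma tendsto_nome_mul {c : ℝ} (hc : 0 < c) :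
    Tendsto (fun τ : ℍ ↦ nome (c * τ)) atImInfty (𝓝 0) := by
  refine (qParam_tendsto_atImInfty (inv_pos.mpr hc)).congr fun τ ↦ ?_
  simp only [nome, Function.Periodic.qParam]
  congr 1
  push_cast
  field_simp

lemma tendsto_slash_T_pow {f : ℍ → ℂ} {v : ℂ} (hf : Tendsto f atImInfty (𝓝 v)) (j : ℤ) (k : ℕ) :
    Tendsto (f ∣[j] (T ^ k)) atImInfty (𝓝 v) := by
  have hT : Tendsto (fun τ : ℍ ↦ T ^ k • τ) atImInfty atImInfty := by
    rw [atImInfty, tendsto_comap_iff]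
    refine tendsto_comap.congr fun τ ↦ ?_
    have := modular_T_zpow_smul τ k
    rw [zpow_natCast] at this
    change τ.im = (T ^ k • τ : ℍ).im
    simp [this]
  refine (hf.comp hT).congr fun τ ↦ ?_
  have := ModularGroup.coe_T_zpow k
  rw [zpow_natCast] at this
  rw [ModularForm.SL_slash_apply, ModularGroup.denom_apply, this]
  simp

lemma exists_tendsto_transl {N : ℕ} (hN : 2 ≤ N) (i : Option (ZMod N)) :
    ∃ v : ℂ, v ≠ 0 ∧ Tendsto (transl N i) atImInfty (𝓝 v) := by
  have : NeZero N := ⟨by lia⟩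
  have hN0 : (N : ℂ) ≠ 0 := by exact_mod_cast (by lia : N ≠ 0)
  have hN1 : (N - 1 : ℂ) ≠ 0 := by
    rw [sub_ne_zero]; exact_mod_cast (by lia : N ≠ 1)
  have hNpos : (0 : ℝ) < N := by exact_mod_cast (by lia : 0 < N)
  have hE : Tendsto (fun τ : ℍ ↦ E2 τ) atImInfty (𝓝 1) := tendsto_E2 tendsto_nome_atImInfty
  rcases i with _ | k
  · have h1 : Tendsto (fun τ : ℍ ↦ E2 (N * τ)) atImInfty (𝓝 1) :=
      tendsto_E2 (by simpa using tendsto_nome_mul hNpos)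
    refine ⟨(N * 1 - 1) / (N - 1), ?_, ((h1.const_mul (N : ℂ)).sub hE).div_const _⟩
    rw [mul_one]
    exact div_ne_zero hN1 hN1
  · have h1 : Tendsto (fun τ : ℍ ↦ E2 ((N : ℂ)⁻¹ * τ)) atImInfty (𝓝 1) :=
      tendsto_E2 (by simpa using tendsto_nome_mul (inv_pos.mpr hNpos))
    have h2 : Tendsto (Etilde N ∣[(2 : ℤ)] S) atImInfty (𝓝 ((1 / N - 1) / (N - 1))) := by
      refine (((h1.div_const (N : ℂ)).sub hE).div_const _).congr fun τ ↦ ?_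
      have him : 0 < ((N : ℂ)⁻¹ * τ).im := by
        have : ((N : ℂ)⁻¹ * τ).im = (N : ℝ)⁻¹ * τ.im := by
          rw [← Complex.ofReal_natCast, ← Complex.ofReal_inv, Complex.im_ofReal_mul]
          rfl
        rw [this]
        exact mul_pos (inv_pos.mpr hNpos) τ.im_pos
      exact (Etilde_slash_S N τ ⟨(N : ℂ)⁻¹ * τ, him⟩ (mul_inv_cancel_left₀ hN0 _).symm).symm
    refine ⟨(1 / N - 1) / (N - 1), div_ne_zero ?_ hN1, ?_⟩
    · rw [div_sub_one hN0, ← neg_sub (N : ℂ) 1]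
      exact div_ne_zero (neg_ne_zero.mpr hN1) hN0
    · rw [transl, SlashAction.slash_mul]
      exact tendsto_slash_T_pow h2 2 k.val

/-! ### The product as a modular form of level one -/

lemma Etilde_mdifferentiable (N : ℕ) [NeZero N] : MDiff (Etilde N) := by
  have hE : DifferentiableOn ℂ E2 upperHalfPlaneSet := by
    refine (UpperHalfPlane.mdifferentiable_iff.mp E2_mdifferentiable).congr fun z hz ↦ ?_
    simp only [Function.comp_apply, ofComplex_apply_of_im_pos hz, ← E2_coe]
  rw [UpperHalfPlane.mdifferentiable_iff]
  have hm : Set.MapsTo (fun z : ℂ ↦ (N : ℂ) * z) upperHalfPlaneSet upperHalfPlaneSet := fun z hz ↦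
    (natScale N ⟨z, hz⟩).im_pos
  have h1 := hE.comp (differentiableOn_id.const_mul (N : ℂ)) hm
  refine (((h1.const_mul (N : ℂ)).sub hE).div_const ((N : ℂ) - 1)).congr fun z hz ↦ ?_
  simp [Etilde, ofComplex_apply_of_im_pos hz]

lemma transl_mdifferentiable (N : ℕ) [NeZero N] (i : Option (ZMod N)) : MDiff (transl N i) := by
  rcases i with _ | k
  · exact Etilde_mdifferentiable N
  · exact (Etilde_mdifferentiable N).slash _ _

lemma exists_tendsto_translProd (N : ℕ) [Fact N.Prime] :
    ∃ v : ℂ, v ≠ 0 ∧ Tendsto (translProd N) atImInfty (𝓝 v) := by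
  choose v hv0 hv using exists_tendsto_transl (Fact.out : N.Prime).two_le
  refine ⟨∏ i, v i, Finset.prod_ne_zero_iff.mpr fun i _ ↦ hv0 i, ?_⟩
  simpa [translProd, Finset.prod_fn] using tendsto_finsetProd Finset.univ fun i _ ↦ hv i

/-- The product of all translates of `Ẽ_N`, as a modular form of level one. -/
noncomputable def translForm (N : ℕ) [Fact N.Prime] : ModularForm 𝒮ℒ (2 * (N + 1)) where
  toFun := translProd N
  slash_action_eq' := fun _ ⟨γ, hγ⟩ ↦ hγ ▸ translProd_slash N γ
  holo' := MDifferentiable.prod fun i _ ↦ transl_mdifferentiable N i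
  bdd_at_cusps' {c} hc := by
    rw [OnePoint.isBoundedAt_iff_forall_SL2Z hc]
    intro γ _
    obtain ⟨v, -, hv⟩ := exists_tendsto_translProd N
    rw [translProd_slash]
    exact hv.isBigO_one ℝ

lemma translForm_apply (N : ℕ) [Fact N.Prime] (τ : ℍ) : translForm N τ = ∏ i, transl N i τ := by
  change translProd N τ = _
  simp [translProd]

lemma coeff_zero_translForm_ne_zero (N : ℕ) [Fact N.Prime] :
    (qExpansion 1 (translForm N)).coeff 0 ≠ 0 := by
  obtain ⟨v, hv0, hv⟩ := exists_tendsto_translProd N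
  rw [qExpansion_coeff_zero one_pos
    (ModularFormClass.analyticAt_cuspFunction_zero _ one_pos one_mem_strictPeriods_SL)
    (SlashInvariantFormClass.periodic_comp_ofComplex _ one_mem_strictPeriods_SL)]
  have : valueAtInfty (translForm N) = v := hv.limUnder_eq
  rwa [this]

/-- Modulo a multiple of a form with value `1` at infinity, every level one form is divisible by
the discriminant. -/
lemma exists_eq_add_discriminant_mul {k : ℤ} (f h : ModularForm 𝒮ℒ k)
    (hh : (qExpansion 1 h).coeff 0 = 1) : ∃ g : ModularForm 𝒮ℒ (k - 12), ∀ τ,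
      f τ = (qExpansion 1 f).coeff 0 * h τ + ModularForm.discriminant τ * g τ := by
  obtain ⟨u, hu⟩ := ModularForm.sub_smul_isCuspForm f h hh
  refine ⟨CuspForm.discriminantEquiv u, fun τ ↦ ?_⟩
  have h1 : u τ = f τ - (qExpansion 1 f).coeff 0 * h τ :=
    congrArg (fun F : ModularForm 𝒮ℒ k ↦ F τ) hu
  rw [ModularForm.discriminant_mul_discriminantEquiv_apply, h1]
  ring

/-! ### The elliptic points `i` and `ρ` -/

lemma rho_eq : rho = -1 / 2 + (√3 / 2 : ℝ) * Complex.I := by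
  have h : (2 * Real.pi * Complex.I / 3 : ℂ) = ((Real.pi - Real.pi / 3 : ℝ) : ℂ) * Complex.I := by
    push_cast; ring
  rw [rho, h, Complex.exp_mul_I, ← Complex.ofReal_cos, ← Complex.ofReal_sin, Real.cos_pi_sub,
    Real.sin_pi_sub, Real.cos_pi_div_three, Real.sin_pi_div_three]
  push_cast; ring

lemma rho_re : rho.re = -1 / 2 := by simp [rho_eq]

lemma rho_im : rho.im = √3 / 2 := by simp [rho_eq]

/-- The elliptic point `ρ = e^{2πi/3}` of the upper half-plane. -/
noncomputable def rhoPt : ℍ := ⟨rho, by rw [rho_im]; positivity⟩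

lemma coe_rhoPt : (rhoPt : ℂ) = rho := rfl

lemma rhoPt_re : rhoPt.re = -1 / 2 := rho_re

lemma rhoPt_im : rhoPt.im = √3 / 2 := rho_im

lemma rho_quadratic : rho ^ 2 + rho + 1 = 0 := by
  have h3 : ((√3 : ℝ) : ℂ) ^ 2 = 3 := by
    rw [← Complex.ofReal_pow, Real.sq_sqrt (by norm_num)]; norm_num
  rw [rho_eq]
  push_cast
  linear_combination (Complex.I ^ 2 / 4) * h3 + 3 / 4 * Complex.I_sq

lemma I_mem_fdSL2Z : I ∈ fdSL2Z := by
  refine ⟨?_, ?_, ?_⟩ <;> norm_num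

lemma rhoPt_mem_fdSL2Z : rhoPt ∈ fdSL2Z := by
  have h3 : (√3) ^ 2 = 3 := Real.sq_sqrt (by norm_num)
  refine ⟨?_, ?_, ?_⟩
  · rw [rhoPt_re]
  · rw [rhoPt_re]; norm_num
  · rw [rhoPt_re, rhoPt_im]; nlinarith

lemma S_smul_I : S • I = I := by
  rw [modular_S_smul]
  ext
  simp

lemma S_mul_T_smul_rhoPt : (S * T) • rhoPt = rhoPt := by
  have h := coe_S_mul_T_pow_smul 1 rhoPt
  rw [pow_one, coe_rhoPt, Nat.cast_one] at h
  have h0 : rho + 1 ≠ 0 := fun h0 ↦ by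
    have := rho_quadratic
    rw [eq_neg_of_add_eq_zero_left h0] at this
    norm_num at this
  ext
  rw [h, coe_rhoPt, div_eq_iff h0]
  linear_combination -rho_quadratic

lemma denom_S_mul_T_rhoPt : denom (S * T : SL(2, ℤ)) rhoPt = rho + 1 := by
  simpa [coe_rhoPt] using denom_S_mul_T_pow 1 rhoPt

lemma rho_ne_one : rho ≠ 1 := fun h ↦ by
  have := rho_re
  rw [h] at this
  norm_num at this

lemma rho_sq_ne_one : rho ^ 2 ≠ 1 := fun h ↦ by
  have h2 : rho = -2 := by linear_combination rho_quadratic - h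
  have := rho_re
  rw [h2] at this
  norm_num at this

lemma eq_zero_I_of_slash_S {f : ℍ → ℂ} (hf : f ∣[(2 : ℤ)] S = f) : f I = 0 :=
  eq_zero_of_slash_eq_of_smul_eq hf S_smul_I (by
    rw [ModularGroup.denom_S, zpow_neg, zpow_ofNat]; norm_num)

lemma eq_zero_rhoPt_of_slash {f : ℍ → ℂ} (hf : f ∣[(2 : ℤ)] (S * T) = f) : f rhoPt = 0 := by
  refine eq_zero_of_slash_eq_of_smul_eq hf S_mul_T_smul_rhoPt ?_
  rw [denom_S_mul_T_rhoPt, zpow_neg, zpow_ofNat, inv_ne_one,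
    show (rho + 1) ^ 2 = rho by linear_combination rho_quadratic]
  exact rho_ne_one

lemma E₆_I : E₆ I = 0 := by
  refine eq_zero_of_slash_eq_of_smul_eq (E₆.slash_action_eq' _ ⟨S, rfl⟩) S_smul_I ?_
  rw [ModularGroup.denom_S, zpow_neg, zpow_ofNat, show (6 : ℕ) = 2 * 3 by rfl, pow_mul]
  norm_num

lemma E₄_rhoPt : E₄ rhoPt = 0 := by
  refine eq_zero_of_slash_eq_of_smul_eq (E₄.slash_action_eq' _ ⟨S * T, rfl⟩)
    S_mul_T_smul_rhoPt ?_
  rw [denom_S_mul_T_rhoPt, zpow_neg, zpow_ofNat, inv_ne_one,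
    show (rho + 1) ^ 4 = rho ^ 2 by
      linear_combination (rho ^ 2 + 3 * rho + 1) * rho_quadratic]
  exact rho_sq_ne_one

lemma E2star_I : E2star I = 0 := eq_zero_I_of_slash_S (E2star_slash S)

lemma E2star_rhoPt : E2star rhoPt = 0 := eq_zero_rhoPt_of_slash (E2star_slash _)

/-! ### Nonvanishing of translates at elliptic points -/

/-- At a zero of `E₂*` one has `(N - 1) Ẽ_N(τ) = N E₂(Nτ) - 3 / (π Im τ)`, which is nonzero when
`Nτ` lies high enough in the half-plane. -/
lemma Etilde_ne_zero_of_E2star_eq_zero {N : ℕ} (hN2 : 2 ≤ N) {τ : ℍ} (h : E2star τ = 0)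
    (him : 2 ≤ N * τ.im) : Etilde N τ ≠ 0 := by
  have hN : (N : ℂ) ≠ 0 := by exact_mod_cast (by lia : N ≠ 0)
  have hN1 : (N - 1 : ℂ) ≠ 0 := by
    rw [sub_ne_zero]; exact_mod_cast (by lia : N ≠ 1)
  have him' : ((N : ℂ) * τ).im = N * τ.im := by simp
  have hne := E2_ne_of_two_le_im (τ := N * τ) (by rwa [him'])
  contrapose! hne
  rw [Etilde, div_eq_zero_iff, or_iff_left hN1, sub_eq_zero] at hne
  rw [E2star, sub_eq_zero] at h
  rw [him', ← mul_right_inj' hN, hne, h]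
  push_cast
  field_simp

lemma transl_some_eq_zero_iff {N : ℕ} {k : ZMod N} {τ : ℍ} :
    transl N (some k) τ = 0 ↔ Etilde N ((S * T ^ k.val) • τ) = 0 := by
  rw [transl, ModularForm.SL_slash_apply, mul_eq_zero,
    or_iff_left (zpow_ne_zero _ (denom_ne_zero _ _))]

lemma transl_some_ne_zero {N : ℕ} (hN : 2 ≤ N) {k : ZMod N} {τ : ℍ}
    (h : E2star τ = 0) (him : 2 * ((τ.re + k.val) ^ 2 + τ.im ^ 2) ≤ N * τ.im) :
    transl N (some k) τ ≠ 0 := by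
  rw [Ne, transl_some_eq_zero_iff]
  refine Etilde_ne_zero_of_E2star_eq_zero hN ?_ ?_
  · have := congrFun (E2star_slash (S * T ^ k.val)) τ
    rw [h, ModularForm.SL_slash_apply, mul_eq_zero,
      or_iff_left (zpow_ne_zero _ (denom_ne_zero _ _))] at this
    exact this
  · have hpos : 0 < (τ.re + k.val) ^ 2 + τ.im ^ 2 := by have := τ.im_pos; positivity
    have hn : Complex.normSq (τ + k.val) = (τ.re + k.val) ^ 2 + τ.im ^ 2 := by
      simp [Complex.normSq_apply, sq]
    rw [ModularGroup.im_smul_eq_div_normSq, denom_S_mul_T_pow, hn, mul_div_assoc',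
      le_div_iff₀ hpos]
    exact him

lemma transl_I_eq_zero_iff_of_mul {N : ℕ} [NeZero N] {k l : ZMod N} (h : k * l = -1) :
    transl N (some l) I = 0 ↔ transl N (some k) I = 0 :=
  eq_zero_iff_of_slash_eq (transl_some_slash_eq_some (by simpa [S] using h)) S_smul_I

lemma transl_I_eq_zero_of_sq {N : ℕ} [NeZero N] {k : ZMod N} (h : k * k = -1) :
    transl N (some k) I = 0 :=
  eq_zero_I_of_slash_S (transl_some_slash_eq_some (by simpa [S] using h))

lemma transl_zero_I_eq_zero_iff {N : ℕ} [NeZero N] :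
    transl N (some 0) I = 0 ↔ Etilde N I = 0 :=
  eq_zero_iff_of_slash_eq (Etilde_slash_eq_transl_some (by simp [S])) S_smul_I

lemma coe_S_mul_T : ((S * T : SL(2, ℤ)) : Matrix (Fin 2) (Fin 2) ℤ) = !![0, -1; 1, 1] := by
  have h := coe_S_mul_T_pow 1
  rwa [pow_one, Nat.cast_one] at h

lemma transl_rhoPt_eq_zero_iff_of_mul {N : ℕ} [NeZero N] {k l : ZMod N} (h : k * l = k - 1) :
    transl N (some l) rhoPt = 0 ↔ transl N (some k) rhoPt = 0 :=
  eq_zero_iff_of_slash_eq (transl_some_slash_eq_some (by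
    rw [coe_S_mul_T]; simpa [neg_add_eq_sub] using h)) S_mul_T_smul_rhoPt

lemma transl_rhoPt_eq_zero_of_sq {N : ℕ} [NeZero N] {k : ZMod N} (h : k * k = k - 1) :
    transl N (some k) rhoPt = 0 :=
  eq_zero_rhoPt_of_slash (transl_some_slash_eq_some (by
    rw [coe_S_mul_T]; simpa [neg_add_eq_sub] using h))

lemma transl_one_rhoPt_eq_zero_iff {N : ℕ} [NeZero N] :
    transl N (some 1) rhoPt = 0 ↔ Etilde N rhoPt = 0 :=
  eq_zero_iff_of_slash_eq (Etilde_slash_eq_transl_some (by rw [coe_S_mul_T]; simp))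
    S_mul_T_smul_rhoPt

lemma transl_zero_rhoPt_eq_zero_iff {N : ℕ} [NeZero N] :
    Etilde N rhoPt = 0 ↔ transl N (some 0) rhoPt = 0 :=
  eq_zero_iff_of_slash_eq (transl_some_slash_eq_none (by rw [coe_S_mul_T]; simp))
    S_mul_T_smul_rhoPt

lemma Etilde_I_ne_zero {N : ℕ} (hN : 2 ≤ N) : Etilde N I ≠ 0 :=
  Etilde_ne_zero_of_E2star_eq_zero hN E2star_I (by simpa using hN)

lemma Etilde_rhoPt_ne_zero {N : ℕ} (hN : 3 ≤ N) : Etilde N rhoPt ≠ 0 := by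
  refine Etilde_ne_zero_of_E2star_eq_zero (by lia) E2star_rhoPt ?_
  rw [rhoPt_im]
  have h3 : (3 : ℝ) ≤ N := by exact_mod_cast hN
  have h2 : (4 / 3 : ℝ) ≤ √3 := Real.le_sqrt_of_sq_le (by norm_num)
  nlinarith

/-! ### The product of translates in low weight -/

lemma coeff_zero_E₄_pow (n : ℕ) : (qExpansion 1 (E₄.pow n)).coeff 0 = 1 := by
  have := EisensteinSeries.E_qExpansion_coeff_zero (k := 4) (by norm_num) ⟨2, rfl⟩
  rw [ModularForm.qExpansion_pow one_pos one_mem_strictPeriods_SL,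
    PowerSeries.coeff_zero_eq_constantCoeff, map_pow,
    ← PowerSeries.coeff_zero_eq_constantCoeff_apply, this, one_pow]

lemma coeff_zero_E₆_pow (n : ℕ) : (qExpansion 1 (E₆.pow n)).coeff 0 = 1 := by
  have := EisensteinSeries.E_qExpansion_coeff_zero (k := 6) (by norm_num) ⟨3, rfl⟩
  rw [ModularForm.qExpansion_pow one_pos one_mem_strictPeriods_SL,
    PowerSeries.coeff_zero_eq_constantCoeff, map_pow,
    ← PowerSeries.coeff_zero_eq_constantCoeff_apply, this, one_pow]

lemma translForm_eq_zero_of_transl_eq_zero {N : ℕ} [Fact N.Prime] {i : Option (ZMod N)} {τ : ℍ}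
    (h : transl N i τ = 0) : translForm N τ = 0 := by
  rw [translForm_apply]
  exact Finset.prod_eq_zero (Finset.mem_univ i) h

lemma exists_translForm_eq_E₆_pow {N : ℕ} [Fact N.Prime] (n : ℕ) (hn : (n * 6 : ℤ) = 2 * (N + 1)) :
    ∃ c : ℂ, c ≠ 0 ∧ ∃ g : ModularForm 𝒮ℒ (2 * (N + 1) - 12), ∀ τ,
      translForm N τ = c * E₆ τ ^ n + ModularForm.discriminant τ * g τ :=
  ⟨_, coeff_zero_translForm_ne_zero N,
    exists_eq_add_discriminant_mul (translForm N) ((E₆.pow n).mcast hn) (coeff_zero_E₆_pow n) |>.imp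
      fun g hg τ ↦ by simpa using hg τ⟩

lemma exists_translForm_eq_E₄_pow {N : ℕ} [Fact N.Prime] (n : ℕ) (hn : (n * 4 : ℤ) = 2 * (N + 1)) :
    ∃ c : ℂ, c ≠ 0 ∧ ∃ g : ModularForm 𝒮ℒ (2 * (N + 1) - 12), ∀ τ,
      translForm N τ = c * E₄ τ ^ n + ModularForm.discriminant τ * g τ :=
  ⟨_, coeff_zero_translForm_ne_zero N,
    exists_eq_add_discriminant_mul (translForm N) ((E₄.pow n).mcast hn) (coeff_zero_E₄_pow n) |>.imp
      fun g hg τ ↦ by simpa using hg τ⟩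

instance fact_prime_seven : Fact (Nat.Prime 7) := ⟨by norm_num⟩

instance fact_prime_five : Fact (Nat.Prime 5) := ⟨by norm_num⟩

lemma E₆_eq_zero_of_translForm_two {τ : ℍ} (h : translForm 2 τ = 0) : E₆ τ = 0 := by
  obtain ⟨c, hc, g, hg⟩ := exists_translForm_eq_E₆_pow (N := 2) 1 (by norm_num)
  have hg0 := ModularFormClass.levelOne_neg_weight_eq_zero (by norm_num) g
  rw [hg, hg0] at h
  simpa [hc] using h

lemma E₄_eq_zero_of_translForm_three {τ : ℍ} (h : translForm 3 τ = 0) : E₄ τ = 0 := by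
  obtain ⟨c, hc, g, hg⟩ := exists_translForm_eq_E₄_pow (N := 3) 2 (by norm_num)
  have hg0 := ModularFormClass.levelOne_neg_weight_eq_zero (by norm_num) g
  rw [hg, hg0] at h
  simpa [hc] using h

/-- The product of translates for `N = 5` has weight 12 and vanishes at `i`, where the discriminant
does not, so it is a multiple of `E₆²`. -/
lemma E₆_eq_zero_of_translForm_five {τ : ℍ} (h : translForm 5 τ = 0) : E₆ τ = 0 := by
  obtain ⟨c, hc, g, hg⟩ := exists_translForm_eq_E₆_pow (N := 5) 2 (by norm_num)
  obtain ⟨a, ha⟩ := ModularFormClass.levelOne_weight_zero_const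
    (g.mcast (by norm_num) : ModularForm 𝒮ℒ 0)
  have hga (τ : ℍ) : g τ = a := congrFun ha τ
  -- the indices `k` with `k² = -1` in `ℤ/5` are fixed by `S`
  have hI := hg I
  rw [translForm_eq_zero_of_transl_eq_zero (transl_I_eq_zero_of_sq (k := 2) (by decide)), E₆_I,
    hga] at hI
  have ha0 : a = 0 := by simpa [ModularForm.discriminant_ne_zero] using hI
  rw [hg, hga, ha0] at h
  simpa [hc] using h

/-- The product of translates has a double zero at a common zero of two translates. -/
lemma hasDerivAt_translForm {N : ℕ} [Fact N.Prime] {i j : Option (ZMod N)} (hij : i ≠ j) {τ : ℍ}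
    (hi : transl N i τ = 0) (hj : transl N j τ = 0) :
    HasDerivAt (translForm N ∘ ofComplex) 0 τ := by
  have hd (i : Option (ZMod N)) := (mdifferentiableAt_iff.mp
    (transl_mdifferentiable N i τ)).hasDerivAt
  have hR := (mdifferentiableAt_iff.mp ((MDifferentiable.prod (t := (Finset.univ.erase i).erase j)
    fun i _ ↦ transl_mdifferentiable N i) τ)).hasDerivAt
  have heq : translForm N ∘ ofComplex = fun z ↦ (transl N i ∘ ofComplex) z *
      ((transl N j ∘ ofComplex) z *
        ((∏ l ∈ (Finset.univ.erase i).erase j, transl N l) ∘ ofComplex) z) := by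
    ext z
    simp only [Function.comp_apply, translForm_apply, Finset.prod_apply]
    rw [Finset.mul_prod_erase _ (fun l ↦ transl N l (ofComplex z)) (by simp [hij.symm]),
      Finset.mul_prod_erase _ (fun l ↦ transl N l (ofComplex z)) (Finset.mem_univ i)]
  rw [heq]
  exact ((hd i).fun_mul ((hd j).fun_mul hR)).congr_deriv (by simp [hi, hj])

/-- `ρ` is a simple zero of `E₄`: near `ρ` the variation of `E₄` bounds that of `q`, whose
derivative does not vanish. -/
lemma ne_zero_of_hasDerivAt_E₄_rhoPt {e : ℂ} (he : HasDerivAt (E₄ ∘ ofComplex) e rhoPt) :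
    e ≠ 0 := by
  rintro rfl
  have him : 17 / 20 < rhoPt.im := by
    rw [rhoPt_im]
    have : (1.72 : ℝ) ≤ √3 := Real.le_sqrt_of_sq_le (by norm_num)
    linarith
  have hbound : (fun z ↦ nome z - nome rhoPt) =O[𝓝 (rhoPt : ℂ)]
      fun z ↦ (E₄ ∘ ofComplex) z - (E₄ ∘ ofComplex) rhoPt := by
    refine Asymptotics.IsBigO.of_bound 1 ?_
    filter_upwards [(Complex.continuous_im.tendsto (rhoPt : ℂ)).eventually_const_le him] with z hz
    have hz0 : 0 < z.im := by linarith
    rw [one_mul, Function.comp_apply, Function.comp_apply, ofComplex_apply,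
      ofComplex_apply_of_im_pos hz0]
    exact norm_nome_sub_le_E₄ (τ := ⟨z, hz0⟩) hz him.le
  have h0 : HasDerivAt nome 0 rhoPt := by
    rw [hasDerivAt_iff_isLittleO] at he ⊢
    simpa using hbound.trans_isLittleO (by simpa using he)
  have h1 : HasDerivAt nome (nome rhoPt * (2 * Real.pi * Complex.I)) rhoPt := by
    simpa using! ((hasDerivAt_id (rhoPt : ℂ)).const_mul (2 * Real.pi * Complex.I)).cexp
  exact mul_ne_zero (Complex.exp_ne_zero _) Complex.two_pi_I_ne_zero (h1.unique h0)

/-- The product of translates for `N = 7` has weight 16, hence is `E₄ (c E₄³ + a Δ)`. It has at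
least a double zero at `ρ`, where `E₄` has a simple zero and `Δ` none, which forces `a = 0`. -/
lemma E₄_eq_zero_of_translForm_seven {τ : ℍ} (h : translForm 7 τ = 0) : E₄ τ = 0 := by
  obtain ⟨c, hc, g, hg⟩ := exists_translForm_eq_E₄_pow (N := 7) 4 (by norm_num)
  obtain ⟨a, ha⟩ := (finrank_eq_one_iff_of_nonzero' E₄
    (EisensteinSeries.E_ne_zero (k := 4) (by norm_num) ⟨2, rfl⟩)).mp
    (Module.rank_eq_one_iff_finrank_eq_one.mp ModularForm.levelOne_weight_four_rank_one)
    (g.mcast (by norm_num) : ModularForm 𝒮ℒ 4)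
  have hga (τ : ℍ) : g τ = a * E₄ τ := (congrArg (fun F : ModularForm 𝒮ℒ 4 ↦ F τ) ha).symm
  have hE := (mdifferentiableAt_iff.mp (E₄.holo' rhoPt)).hasDerivAt
  have hΔ := (mdifferentiableAt_iff.mp (CuspForm.discriminant.holo' rhoPt)).hasDerivAt
  have hprod := hE.fun_mul (((hE.fun_pow 3).const_mul c).fun_add (hΔ.const_mul a))
  -- `3` and `5` are the roots of `k² - k + 1` in `ℤ/7`, the indices fixed by `S T`
  have hzero := hasDerivAt_translForm (N := 7) (i := some 3) (j := some 5) (by decide)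
    (transl_rhoPt_eq_zero_of_sq (by decide)) (transl_rhoPt_eq_zero_of_sq (by decide))
  have heq := (hprod.congr_of_eventuallyEq (Eventually.of_forall fun z ↦ by
    change translForm 7 (ofComplex z) = E₄ (ofComplex z) * (c * E₄ (ofComplex z) ^ 3 +
      a * ModularForm.discriminant (ofComplex z))
    rw [hg, hga]
    ring)).unique hzero
  have hΔ0 : ModularForm.discriminant rhoPt ≠ 0 := ModularForm.discriminant_ne_zero _
  have ha0 : a = 0 := by
    have hE0 := ne_zero_of_hasDerivAt_E₄_rhoPt hE
    have h3 : deriv (E₄ ∘ ofComplex) rhoPt = 0 ∨ a = 0 ∨ ModularForm.discriminant rhoPt = 0 := by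
      simpa [E₄_rhoPt] using heq
    exact (h3.resolve_left hE0).resolve_right hΔ0
  rw [hg, hga, ha0] at h
  simpa [hc] using h

/-! ### The zeros in the fundamental domain -/

/-- If the translates of `Ẽ_p` vanish on the fundamental domain of `SL₂(ℤ)` at most at `τ₀`, and
`Ẽ_p` itself does not vanish there, then the zeros of `Ẽ_p` in `F_p` are the points `S T^k τ₀` for
those `k` whose translate vanishes at `τ₀`. -/
lemma zerosInFd_eq {p : ℕ} [NeZero p] {τ₀ : ℍ} (h₀ : τ₀ ∈ fdSL2Z)
    (huniq : ∀ τ ∈ fdSL2Z, ∀ i, transl p i τ = 0 → τ = τ₀) (hne : Etilde p τ₀ ≠ 0) :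
    zerosInFd p = {z | ∃ k : ZMod p, transl p (some k) τ₀ = 0 ∧ z = -1 / ((τ₀ : ℂ) + k.val)} := by
  ext z
  constructor
  · rintro ⟨τ, ⟨hτ, hz⟩, rfl⟩
    rcases hτ with hτ | hτ
    · exact absurd (huniq τ hτ none hz ▸ hz) hne
    · simp only [Set.mem_iUnion] at hτ
      obtain ⟨k, hk, τ', hτ', rfl⟩ := hτ
      have hval : (k : ZMod p).val = k := ZMod.val_cast_of_lt (Finset.mem_range.mp hk)
      have hz' : transl p (some (k : ZMod p)) τ' = 0 := by
        rw [transl_some_eq_zero_iff, hval]; exact hz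
      obtain rfl := huniq τ' hτ' _ hz'
      refine ⟨k, hz', ?_⟩
      rw [hval]
      exact coe_S_mul_T_pow_smul k τ'
  · rintro ⟨k, hk, rfl⟩
    rw [← coe_S_mul_T_pow_smul]
    refine ⟨_, ⟨Or.inr ?_, transl_some_eq_zero_iff.mp hk⟩, rfl⟩
    simp only [Set.mem_iUnion]
    exact ⟨k.val, Finset.mem_range.mpr k.val_lt, τ₀, h₀, rfl⟩

lemma eq_I_of_transl_eq_zero {p : ℕ} [Fact p.Prime] (h : ∀ τ, translForm p τ = 0 → E₆ τ = 0)
    (τ : ℍ) (hτ : τ ∈ fdSL2Z) (i : Option (ZMod p)) (hi : transl p i τ = 0) : τ = I :=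
  eq_of_E₆_eq hτ I_mem_fdSL2Z
    ((h τ (translForm_eq_zero_of_transl_eq_zero hi)).trans E₆_I.symm)

lemma eq_rhoPt_of_transl_eq_zero {p : ℕ} [Fact p.Prime] (h : ∀ τ, translForm p τ = 0 → E₄ τ = 0)
    (τ : ℍ) (hτ : τ ∈ fdSL2Z) (i : Option (ZMod p)) (hi : transl p i τ = 0) : τ = rhoPt :=
  eq_of_E₄_eq hτ rhoPt_mem_fdSL2Z
    ((h τ (translForm_eq_zero_of_transl_eq_zero hi)).trans E₄_rhoPt.symm)

lemma zerosInFd_two : zerosInFd 2 = {-1 / (Complex.I + 1)} := by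
  have hne : Etilde 2 I ≠ 0 := Etilde_I_ne_zero le_rfl
  rw [zerosInFd_eq I_mem_fdSL2Z
    (eq_I_of_transl_eq_zero fun _ ↦ E₆_eq_zero_of_translForm_two) hne]
  have h0 : transl 2 (some 0) I ≠ 0 := mt transl_zero_I_eq_zero_iff.mp hne
  have h1 : transl 2 (some 1) I = 0 := transl_I_eq_zero_of_sq (by decide)
  have hv : (1 : ZMod 2).val = 1 := rfl
  ext z
  constructor
  · rintro ⟨k, hk, rfl⟩
    fin_cases k
    · exact absurd hk h0
    · simp [ZMod.val]
  · rintro rfl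
    exact ⟨1, h1, by simp [hv]⟩

lemma zerosInFd_three : zerosInFd 3 = {-1 / (rho + 2)} := by
  have hne : Etilde 3 rhoPt ≠ 0 := Etilde_rhoPt_ne_zero le_rfl
  rw [zerosInFd_eq rhoPt_mem_fdSL2Z
    (eq_rhoPt_of_transl_eq_zero fun _ ↦ E₄_eq_zero_of_translForm_three) hne]
  have h0 : transl 3 (some 0) rhoPt ≠ 0 := mt transl_zero_rhoPt_eq_zero_iff.mpr hne
  have h1 : transl 3 (some 1) rhoPt ≠ 0 := mt transl_one_rhoPt_eq_zero_iff.mp hne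
  have h2 : transl 3 (some 2) rhoPt = 0 := transl_rhoPt_eq_zero_of_sq (by decide)
  have hv : (2 : ZMod 3).val = 2 := rfl
  ext z
  constructor
  · rintro ⟨k, hk, rfl⟩
    fin_cases k
    · exact absurd hk h0
    · exact absurd hk h1
    · simp [ZMod.val, coe_rhoPt]
  · rintro rfl
    exact ⟨2, h2, by simp [hv, coe_rhoPt]⟩

lemma zerosInFd_five : zerosInFd 5 = {-1 / (Complex.I + 2), -1 / (Complex.I + 3)} := by
  have hne : Etilde 5 I ≠ 0 := Etilde_I_ne_zero (by norm_num)
  rw [zerosInFd_eq I_mem_fdSL2Z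
    (eq_I_of_transl_eq_zero fun _ ↦ E₆_eq_zero_of_translForm_five) hne]
  have hv1 : (1 : ZMod 5).val = 1 := rfl
  have hv2 : (2 : ZMod 5).val = 2 := rfl
  have hv3 : (3 : ZMod 5).val = 3 := rfl
  have h0 : transl 5 (some 0) I ≠ 0 := mt transl_zero_I_eq_zero_iff.mp hne
  have h1 : transl 5 (some 1) I ≠ 0 := by
    refine transl_some_ne_zero (by norm_num) E2star_I ?_
    rw [hv1]
    norm_num
  have h2 : transl 5 (some 2) I = 0 := transl_I_eq_zero_of_sq (by decide)
  have h3 : transl 5 (some 3) I = 0 := transl_I_eq_zero_of_sq (by decide)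
  -- `S` exchanges the indices `1` and `4 = -1/1`
  have h4 : transl 5 (some 4) I ≠ 0 := mt (transl_I_eq_zero_iff_of_mul (by decide)).mp h1
  ext z
  constructor
  · rintro ⟨k, hk, rfl⟩
    fin_cases k
    · exact absurd hk h0
    · exact absurd hk h1
    · simp [ZMod.val]
    · simp [ZMod.val]
    · exact absurd hk h4
  · rintro (rfl | rfl)
    · exact ⟨2, h2, by simp [hv2]⟩
    · exact ⟨3, h3, by simp [hv3]⟩

lemma zerosInFd_seven : zerosInFd 7 = {-1 / (rho + 3), -1 / (rho + 5)} := by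
  have hne : Etilde 7 rhoPt ≠ 0 := Etilde_rhoPt_ne_zero (by norm_num)
  rw [zerosInFd_eq rhoPt_mem_fdSL2Z
    (eq_rhoPt_of_transl_eq_zero fun _ ↦ E₄_eq_zero_of_translForm_seven) hne]
  have hv2 : (2 : ZMod 7).val = 2 := rfl
  have hv3 : (3 : ZMod 7).val = 3 := rfl
  have hv5 : (5 : ZMod 7).val = 5 := rfl
  have h0 : transl 7 (some 0) rhoPt ≠ 0 := mt transl_zero_rhoPt_eq_zero_iff.mpr hne
  have h1 : transl 7 (some 1) rhoPt ≠ 0 := mt transl_one_rhoPt_eq_zero_iff.mp hne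
  -- `S T` permutes the indices `2`, `4`, `6` cyclically; of the three points `-1 / (ρ + k)` the one
  -- with `k = 2` has the largest imaginary part, and only it satisfies `7 Im τ ≥ 2`
  have h2 : transl 7 (some 2) rhoPt ≠ 0 := by
    refine transl_some_ne_zero (by norm_num) E2star_rhoPt ?_
    have hs : (√3) ^ 2 = 3 := Real.sq_sqrt (by norm_num)
    have hs' : (12 / 7 : ℝ) ≤ √3 := Real.le_sqrt_of_sq_le (by norm_num)
    rw [hv2, rhoPt_re, rhoPt_im, div_pow, hs]
    norm_num
    linarith
  have h3 : transl 7 (some 3) rhoPt = 0 := transl_rhoPt_eq_zero_of_sq (by decide)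
  have h4 : transl 7 (some 4) rhoPt ≠ 0 :=
    mt (transl_rhoPt_eq_zero_iff_of_mul (k := 2) (by decide)).mp h2
  have h5 : transl 7 (some 5) rhoPt = 0 := transl_rhoPt_eq_zero_of_sq (by decide)
  have h6 : transl 7 (some 6) rhoPt ≠ 0 :=
    mt (transl_rhoPt_eq_zero_iff_of_mul (k := 4) (by decide)).mp h4
  ext z
  constructor
  · rintro ⟨k, hk, rfl⟩
    fin_cases k
    · exact absurd hk h0
    · exact absurd hk h1
    · exact absurd hk h2
    · simp [ZMod.val, coe_rhoPt]
    · exact absurd hk h4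
    · simp [ZMod.val, coe_rhoPt]
    · exact absurd hk h6
  · rintro (rfl | rfl)
    · exact ⟨3, h3, by simp [hv3, coe_rhoPt]⟩
    · exact ⟨5, h5, by simp [hv5, coe_rhoPt]⟩

lemma nonzeroAtCusp_Etilde (N : ℕ) [Fact N.Prime] (c : OnePoint ℝ) :
    NonzeroAtCusp 2 (Etilde N) c := by
  intro γ _
  obtain ⟨i, hi⟩ := exists_Etilde_slash_eq_transl N γ
  rw [hi]
  exact exists_tendsto_transl (Fact.out : N.Prime).two_le i

end EisensteinZeros

/-- The zeros of `Ẽ_N` in the fundamental domain `F_N` of `Γ₀(N)` for `N = 2, 3, 5, 7`, and the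
nonvanishing of `Ẽ_N` at all cusps of `Γ₀(N)`. -/
theorem theorem1 :
    EisensteinZeros.zerosInFd 2 = {-1 / (Complex.I + 1)} ∧
    EisensteinZeros.zerosInFd 3 = {-1 / (EisensteinZeros.rho + 2)} ∧
    EisensteinZeros.zerosInFd 5 = {-1 / (Complex.I + 2), -1 / (Complex.I + 3)} ∧
    EisensteinZeros.zerosInFd 7 =
      {-1 / (EisensteinZeros.rho + 3), -1 / (EisensteinZeros.rho + 5)} ∧
    ∀ N ∈ ({2, 3, 5, 7} : Finset ℕ), ∀ c : OnePoint ℝ,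
      IsCusp c (CongruenceSubgroup.Gamma0 N : Subgroup (GL (Fin 2) ℝ)) →
        EisensteinZeros.NonzeroAtCusp 2 (EisensteinZeros.Etilde N) c := by
  refine ⟨EisensteinZeros.zerosInFd_two, EisensteinZeros.zerosInFd_three,
    EisensteinZeros.zerosInFd_five, EisensteinZeros.zerosInFd_seven, fun N hN c _ ↦ ?_⟩
  have : Fact N.Prime := ⟨by fin_cases hN <;> norm_num⟩
  exact EisensteinZeros.nonzeroAtCusp_Etilde N c
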